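/- Let $n\ge 1$, let $(a_{i,j})_{1\le i,j\le n}$ be real numbers that are not all zero, and let $\Pi$ be a uniformly distributed random permutation of $\{1,\dots,n\}$. Set $$Z=\sum_{i=1}^n a_{i,\Pi(i)},\qquad V=\frac1n\sum_{i,j=1}^n a_{i,j}^2 .$$ Then, for all $x>0$, $$\mathbb P\Big(|Z-\mathbb E[Z]|\ \ge\ 2\sqrt{2Vx}+2\max_{1\le i,j\le n}|a_{i,j}|\,x\Big)\ \le\ 16\,e^{1/16}\,e^{-x/16}.$$ -/

import Mathlib

open MeasureTheory
open scoped Nat ENNReal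

/-- `Pi` is a uniformly distributed random permutation of an `n`-element set, defined on the
probability space `(Ω, P)`: it is measurable (for the discrete σ-algebra on the finite set of
permutations) and takes each of the `n!` permutations with probability `1 / n!`. -/
structure IsUniformRandomPerm {Ω : Type*} [MeasurableSpace Ω] (P : Measure Ω) {n : ℕ}
    (Pi : Ω → Equiv.Perm (Fin n)) : Prop where
  measurableSet_preimage : ∀ σ : Equiv.Perm (Fin n), MeasurableSet (Pi ⁻¹' {σ})
  prob_eq : ∀ σ : Equiv.Perm (Fin n), P (Pi ⁻¹' {σ}) = (n ! : ℝ≥0∞)⁻¹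

/-- The permuted sum `Z(σ) = ∑ i, a i (σ i)`. -/
def permutedSum {n : ℕ} (a : Fin n → Fin n → ℝ) (σ : Equiv.Perm (Fin n)) : ℝ :=
  ∑ i, a i (σ i)

/-- `V = (1 / n) ∑ i j, (a i j)²`. -/
noncomputable def sqMean {n : ℕ} (a : Fin n → Fin n → ℝ) : ℝ :=
  (1 / (n : ℝ)) * ∑ i, ∑ j, a i j ^ 2

/-- The largest absolute value of an entry (the index set is finite, so that for `n ≥ 1` the
supremum is a maximum). -/
noncomputable def maxAbs {n : ℕ} (a : Fin n → Fin n → ℝ) : ℝ :=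
  ⨆ p : Fin n × Fin n, |a p.1 p.2|

/-- The permuted sum, centered at its mean over all permutations. -/
noncomputable def centeredPermutedSum {n : ℕ} (a : Fin n → Fin n → ℝ) (σ : Equiv.Perm (Fin n)) : ℝ :=
  permutedSum a σ - (1 / (n : ℝ)) * ∑ i, ∑ j, a i j

section PermutedSum

variable {n : ℕ} (a : Fin n → Fin n → ℝ)

theorem centeredPermutedSum_neg (σ : Equiv.Perm (Fin n)) :
    centeredPermutedSum (fun i j => -a i j) σ = -centeredPermutedSum a σ := by
  simp only [centeredPermutedSum, permutedSum, Finset.sum_neg_distrib]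
  ring

theorem permutedSum_sub_mul_swap (σ : Equiv.Perm (Fin n)) (i j : Fin n) :
    permutedSum a σ - permutedSum a (σ * Equiv.swap i j) =
      a i (σ i) + a j (σ j) - a i (σ j) - a j (σ i) := by
  rcases eq_or_ne i j with rfl | hij
  · rw [show Equiv.swap i i = 1 from Equiv.swap_self i]
    simp
  · unfold permutedSum
    rw [← Finset.sum_sub_distrib, Finset.sum_eq_add i j hij]
    · simp only [Equiv.Perm.mul_apply, Equiv.swap_apply_left, Equiv.swap_apply_right]
      ring
    · rintro k - ⟨hki, hkj⟩
      simp [Equiv.swap_apply_of_ne_of_ne hki hkj]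
    · simp
    · simp

theorem sum_sum_apply_perm (σ : Equiv.Perm (Fin n)) :
    ∑ i, ∑ j, a i (σ j) = ∑ i, ∑ j, a i j :=
  Finset.sum_congr rfl fun i _ => Equiv.sum_comp σ (a i)

theorem sum_sum_apply_perm_swap (σ : Equiv.Perm (Fin n)) :
    ∑ i, ∑ j, a j (σ i) = ∑ i, ∑ j, a i j := by
  rw [Finset.sum_comm, sum_sum_apply_perm]

theorem sum_swap_sub (hn : n ≠ 0) (σ : Equiv.Perm (Fin n)) :
    ∑ i, ∑ j, (permutedSum a σ - permutedSum a (σ * Equiv.swap i j)) =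
      2 * n * centeredPermutedSum a σ := by
  have hn' : (n : ℝ) ≠ 0 := by exact_mod_cast hn
  simp only [permutedSum_sub_mul_swap]
  simp only [Finset.sum_sub_distrib, Finset.sum_add_distrib,
    sum_sum_apply_perm, sum_sum_apply_perm_swap, Finset.sum_const, Finset.card_univ,
    Fintype.card_fin, nsmul_eq_mul, ← Finset.mul_sum, centeredPermutedSum, permutedSum]
  field_simp
  ring

theorem sum_swap_sub_sq_le (hn : n ≠ 0) (σ : Equiv.Perm (Fin n)) :
    ∑ i, ∑ j, (permutedSum a σ - permutedSum a (σ * Equiv.swap i j)) ^ 2 ≤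
      8 * n * (permutedSum (fun i j => a i j ^ 2) σ + sqMean a) := by
  have hn' : (n : ℝ) ≠ 0 := by exact_mod_cast hn
  calc ∑ i, ∑ j, (permutedSum a σ - permutedSum a (σ * Equiv.swap i j)) ^ 2
      ≤ ∑ i, ∑ j, 4 * (a i (σ i) ^ 2 + a j (σ j) ^ 2 + a i (σ j) ^ 2 + a j (σ i) ^ 2) := by
        refine Finset.sum_le_sum fun i _ => Finset.sum_le_sum fun j _ => ?_
        rw [permutedSum_sub_mul_swap]
        generalize a i (σ i) = p, a j (σ j) = q, a i (σ j) = r, a j (σ i) = s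
        nlinarith [sq_nonneg (p - q), sq_nonneg (p + r), sq_nonneg (p + s), sq_nonneg (q + r),
          sq_nonneg (q + s), sq_nonneg (r - s)]
    _ = _ := by
        simp only [← Finset.mul_sum, Finset.sum_add_distrib,
          sum_sum_apply_perm (fun i j => a i j ^ 2), sum_sum_apply_perm_swap (fun i j => a i j ^ 2),
          Finset.sum_const, Finset.card_univ, Fintype.card_fin, nsmul_eq_mul, permutedSum, sqMean]
        field_simp
        ring

theorem sub_mul_exp_sub_exp_le (x y : ℝ) :
    (x - y) * (Real.exp x - Real.exp y) ≤ (x - y) ^ 2 * (Real.exp x + Real.exp y) := by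
  wlog h : y ≤ x generalizing x y
  · linarith [this y x (by linarith)]
  have h1 : Real.exp x - Real.exp y ≤ (x - y) * Real.exp x := by
    have h2 := Real.add_one_le_exp (y - x)
    have h3 : Real.exp y = Real.exp (y - x) * Real.exp x := by
      rw [← Real.exp_add]; congr 1; ring
    nlinarith [Real.exp_pos x]
  nlinarith [mul_le_mul_of_nonneg_left h1 (sub_nonneg.2 h),
    mul_nonneg (sq_nonneg (x - y)) (Real.exp_pos y).le]

/-- Summing over the exchangeable pairs `(σ, σ * swap i j)`. -/
theorem sum_centeredPermutedSum_mul_exp_le (hn : n ≠ 0) {t : ℝ} (ht : 0 ≤ t) :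
    ∑ σ, centeredPermutedSum a σ * Real.exp (t * centeredPermutedSum a σ) ≤
      4 * t * ∑ σ, (permutedSum (fun i j => a i j ^ 2) σ + sqMean a) *
        Real.exp (t * centeredPermutedSum a σ) := by
  have hn' : (0 : ℝ) < n := by exact_mod_cast Nat.pos_of_ne_zero hn
  set Z := permutedSum a with hZ
  set e : Equiv.Perm (Fin n) → ℝ := fun σ => Real.exp (t * centeredPermutedSum a σ) with he
  have reindex (i j : Fin n) (f : Equiv.Perm (Fin n) → Equiv.Perm (Fin n) → ℝ) :
      ∑ σ, f σ (σ * Equiv.swap i j) = ∑ σ, f (σ * Equiv.swap i j) σ := by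
    rw [← Equiv.sum_comp (Equiv.mulRight (Equiv.swap i j))]
    simp [mul_assoc]
  have pair (i j : Fin n) : ∑ σ, (Z σ - Z (σ * Equiv.swap i j)) * e σ ≤
      t * ∑ σ, (Z σ - Z (σ * Equiv.swap i j)) ^ 2 * e σ := by
    have h1 := reindex i j fun σ τ => (Z σ - Z τ) * e σ
    have h2 := reindex i j fun σ τ => (Z σ - Z τ) ^ 2 * e σ
    have h3 : ∑ σ, (Z σ - Z (σ * Equiv.swap i j)) * (e σ - e (σ * Equiv.swap i j)) ≤
        ∑ σ, t * ((Z σ - Z (σ * Equiv.swap i j)) ^ 2 * (e σ + e (σ * Equiv.swap i j))) := by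
      refine Finset.sum_le_sum fun σ _ => ?_
      rcases ht.eq_or_lt with rfl | ht
      · simp [he]
      have h := sub_mul_exp_sub_exp_le (t * centeredPermutedSum a σ)
        (t * centeredPermutedSum a (σ * Equiv.swap i j))
      have h' : t * centeredPermutedSum a σ - t * centeredPermutedSum a (σ * Equiv.swap i j) =
          t * (Z σ - Z (σ * Equiv.swap i j)) := by
        simp only [centeredPermutedSum, hZ]; ring
      rw [h'] at h
      refine le_of_mul_le_mul_left ?_ ht
      simp only [he]
      linarith
    have h4 : ∑ σ, (Z σ - Z (σ * Equiv.swap i j)) * (e σ - e (σ * Equiv.swap i j)) =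
        2 * ∑ σ, (Z σ - Z (σ * Equiv.swap i j)) * e σ := by
      rw [two_mul]
      nth_rw 2 [h1]
      rw [← Finset.sum_add_distrib]
      exact Finset.sum_congr rfl fun σ _ => by ring
    have h6 : ∑ σ, t * ((Z σ - Z (σ * Equiv.swap i j)) ^ 2 * (e σ + e (σ * Equiv.swap i j))) =
        t * (2 * ∑ σ, (Z σ - Z (σ * Equiv.swap i j)) ^ 2 * e σ) := by
      rw [← Finset.mul_sum, two_mul]
      nth_rw 2 [h2]
      rw [← Finset.sum_add_distrib]
      exact congrArg _ (Finset.sum_congr rfl fun σ _ => by ring)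
    linarith
  have h1 : 2 * n * ∑ σ, centeredPermutedSum a σ * e σ =
      ∑ i, ∑ j, ∑ σ, (Z σ - Z (σ * Equiv.swap i j)) * e σ := by
    have (i : Fin n) : ∑ j, ∑ σ, (Z σ - Z (σ * Equiv.swap i j)) * e σ =
      ∑ σ, ∑ j, (Z σ - Z (σ * Equiv.swap i j)) * e σ := Finset.sum_comm
    simp only [this]
    rw [Finset.sum_comm, Finset.mul_sum]
    refine Finset.sum_congr rfl fun σ _ => ?_
    simp only [← Finset.sum_mul]
    rw [sum_swap_sub a hn]
    ring
  have h2 : ∑ i, ∑ j, t * ∑ σ, (Z σ - Z (σ * Equiv.swap i j)) ^ 2 * e σ ≤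
      t * ∑ σ, 8 * n * (permutedSum (fun i j => a i j ^ 2) σ + sqMean a) * e σ := by
    simp only [← Finset.mul_sum]
    refine mul_le_mul_of_nonneg_left ?_ ht
    have (i : Fin n) : ∑ j, ∑ σ, (Z σ - Z (σ * Equiv.swap i j)) ^ 2 * e σ =
      ∑ σ, ∑ j, (Z σ - Z (σ * Equiv.swap i j)) ^ 2 * e σ := Finset.sum_comm
    simp only [this]
    rw [Finset.sum_comm]
    refine Finset.sum_le_sum fun σ _ => ?_
    simp only [← Finset.sum_mul]
    exact mul_le_mul_of_nonneg_right (sum_swap_sub_sq_le a hn σ) (Real.exp_pos _).le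
  have h3 := h1.trans_le ((Finset.sum_le_sum fun i _ => Finset.sum_le_sum fun j _ =>
    pair i j).trans h2)
  simp only [mul_assoc, ← Finset.mul_sum] at h3 ⊢
  have h4 : 0 < 2 * (n : ℝ) := by positivity
  refine le_of_mul_le_mul_left ?_ h4
  linarith

theorem sum_centeredPermutedSum (hn : n ≠ 0) : ∑ σ, centeredPermutedSum a σ = 0 := by
  have h1 := sum_centeredPermutedSum_mul_exp_le a hn le_rfl
  have h2 := sum_centeredPermutedSum_mul_exp_le (fun i j => -a i j) hn le_rfl
  simp only [centeredPermutedSum_neg, zero_mul, mul_zero, Real.exp_zero, mul_one,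
    Finset.sum_neg_distrib] at h1 h2
  linarith

theorem factorial_le_sum_exp (hn : n ≠ 0) (t : ℝ) :
    (n ! : ℝ) ≤ ∑ σ, Real.exp (t * centeredPermutedSum a σ) := by
  have h : ∑ σ, (t * centeredPermutedSum a σ + 1) ≤
      ∑ σ, Real.exp (t * centeredPermutedSum a σ) :=
    Finset.sum_le_sum fun σ _ => Real.add_one_le_exp _
  rw [Finset.sum_add_distrib, ← Finset.mul_sum, sum_centeredPermutedSum a hn] at h
  simpa [Fintype.card_perm] using h

/-- A differential inequality for the exponential moments integrates to a Gaussian bound. -/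
theorem sum_exp_mul_le {ι : Type*} [Fintype ι] (X : ι → ℝ) {L K : ℝ} (hL : 0 ≤ L)
    (h : ∀ t, 0 ≤ t → t ≤ L →
      ∑ σ, X σ * Real.exp (t * X σ) ≤ K * t * ∑ σ, Real.exp (t * X σ)) :
    ∑ σ, Real.exp (L * X σ) ≤ Fintype.card ι * Real.exp (K * L ^ 2 / 2) := by
  set F : ℝ → ℝ := fun t => (∑ σ, Real.exp (t * X σ)) * Real.exp (-(K * t ^ 2 / 2)) with hF
  have hd (t : ℝ) : HasDerivAt F ((∑ σ, X σ * Real.exp (t * X σ)) * Real.exp (-(K * t ^ 2 / 2)) +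
      (∑ σ, Real.exp (t * X σ)) * (Real.exp (-(K * t ^ 2 / 2)) * -(K * t))) t := by
    have h1 : HasDerivAt (fun t : ℝ => ∑ σ, Real.exp (t * X σ))
        (∑ σ, X σ * Real.exp (t * X σ)) t := by
      refine HasDerivAt.fun_sum fun σ _ => ?_
      have := ((hasDerivAt_id t).mul_const (X σ)).exp
      simpa [mul_comm] using this
    have h2 : HasDerivAt (fun t : ℝ => -(K * t ^ 2 / 2)) (-(K * t)) t := by
      exact (((hasDerivAt_pow 2 t).const_mul K).div_const 2).neg.congr_deriv (by norm_num; ring)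
    exact h1.mul h2.exp
  have hanti : AntitoneOn F (Set.Icc 0 L) := by
    refine antitoneOn_of_deriv_nonpos (convex_Icc 0 L)
      (fun t _ => (hd t).continuousAt.continuousWithinAt)
      (fun t _ => (hd t).differentiableAt.differentiableWithinAt) fun t ht => ?_
    rw [interior_Icc] at ht
    rw [(hd t).deriv]
    have := mul_le_mul_of_nonneg_right (h t ht.1.le ht.2.le) (Real.exp_pos (-(K * t ^ 2 / 2))).le
    linarith
  have h3 := hanti (Set.left_mem_Icc.2 hL) (Set.right_mem_Icc.2 hL) hL
  simp only [hF, zero_mul, Real.exp_zero, Finset.sum_const, Finset.card_univ, nsmul_eq_mul,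
    mul_one] at h3
  rw [Real.exp_neg] at h3
  have h4 := Real.exp_pos (K * L ^ 2 / 2)
  rw [← div_eq_mul_inv, div_le_iff₀ h4] at h3
  simpa using h3

theorem sqMean_nonneg : 0 ≤ sqMean a := by
  unfold sqMean
  positivity

theorem sum_exp_permutedSum_sq_le (hn : n ≠ 0) {M : ℝ} (hM : ∀ i j, |a i j| ≤ M) {t : ℝ}
    (ht : 0 ≤ t) (htM : 8 * M ^ 2 * t ≤ 1) :
    ∑ σ, Real.exp (t * permutedSum (fun i j => a i j ^ 2) σ) ≤
      n ! * Real.exp (2 * t * sqMean a) := by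
  set b : Fin n → Fin n → ℝ := fun i j => a i j ^ 2 with hb
  have hV := sqMean_nonneg a
  have hb2 (i j : Fin n) : b i j ^ 2 ≤ M ^ 2 * b i j := by
    have : a i j ^ 2 ≤ M ^ 2 := sq_le_sq.2 ((hM i j).trans (le_abs_self M))
    simp only [hb]
    nlinarith [sq_nonneg (a i j)]
  have hW (σ : Equiv.Perm (Fin n)) :
      permutedSum b σ = centeredPermutedSum b σ + sqMean a := by
    simp [centeredPermutedSum, sqMean, hb]
  have hW2 (σ : Equiv.Perm (Fin n)) :
      permutedSum (fun i j => b i j ^ 2) σ ≤ M ^ 2 * permutedSum b σ := by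
    simp only [permutedSum, Finset.mul_sum]
    exact Finset.sum_le_sum fun i _ => hb2 i _
  have hV2 : sqMean b ≤ M ^ 2 * sqMean a := by
    have : ∑ i, ∑ j, b i j ^ 2 ≤ M ^ 2 * ∑ i, ∑ j, a i j ^ 2 := by
      simp only [Finset.mul_sum]
      exact Finset.sum_le_sum fun i _ => Finset.sum_le_sum fun j _ => hb2 i j
    have h := mul_le_mul_of_nonneg_left this (show (0 : ℝ) ≤ 1 / n by positivity)
    simp only [sqMean]
    linarith
  have key := sum_exp_mul_le (centeredPermutedSum b) (K := 16 * M ^ 2 * sqMean a) ht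
    fun s hs hst => by
      have h1 := sum_centeredPermutedSum_mul_exp_le b hn hs
      set D := ∑ σ, centeredPermutedSum b σ * Real.exp (s * centeredPermutedSum b σ)
      set m := ∑ σ, Real.exp (s * centeredPermutedSum b σ) with hm
      have hm0 : 0 ≤ m := Finset.sum_nonneg fun σ _ => (Real.exp_pos _).le
      have h2 : ∑ σ, (permutedSum (fun i j => b i j ^ 2) σ + sqMean b) *
          Real.exp (s * centeredPermutedSum b σ) ≤ M ^ 2 * (D + 2 * sqMean a * m) := by
        rw [hm, Finset.mul_sum, ← Finset.sum_add_distrib, Finset.mul_sum]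
        refine Finset.sum_le_sum fun σ _ => ?_
        have h3 : permutedSum (fun i j => b i j ^ 2) σ + sqMean b ≤
            M ^ 2 * (centeredPermutedSum b σ + 2 * sqMean a) := by
          have := hW2 σ
          rw [hW] at this
          linarith
        have := mul_le_mul_of_nonneg_right h3 (Real.exp_pos (s * centeredPermutedSum b σ)).le
        linarith
      have h4 := h1.trans (mul_le_mul_of_nonneg_left h2 (by positivity : 0 ≤ 4 * s))
      have h5 : 8 * M ^ 2 * s ≤ 1 :=
        (mul_le_mul_of_nonneg_left hst (by positivity)).trans htM
      rcases le_total D 0 with hD | hD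
      · exact hD.trans (by positivity)
      · nlinarith [mul_le_mul_of_nonneg_right h5 hD]
  rw [Fintype.card_perm, Fintype.card_fin] at key
  simp only [hW, mul_add, Real.exp_add, ← Finset.sum_mul]
  refine (mul_le_mul_of_nonneg_right key (Real.exp_pos _).le).trans ?_
  rw [mul_assoc, ← Real.exp_add]
  gcongr
  nlinarith [mul_le_mul_of_nonneg_right htM (mul_nonneg ht hV)]

theorem sum_exp_centeredPermutedSum_le (hn : n ≠ 0) {M : ℝ} (hM0 : 0 < M)
    (hM : ∀ i j, |a i j| ≤ M) {t : ℝ} (ht : 0 ≤ t) (htM : 8 * M * t ≤ 1) :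
    ∑ σ, Real.exp (t * centeredPermutedSum a σ) ≤ n ! * Real.exp (12 * sqMean a * t ^ 2) := by
  have hV := sqMean_nonneg a
  have key := sum_exp_mul_le (centeredPermutedSum a) (K := 24 * sqMean a) ht
    fun s hs hst => by
      have h1 := sum_centeredPermutedSum_mul_exp_le a hn hs
      have hone := factorial_le_sum_exp a hn s
      set D := ∑ σ, centeredPermutedSum a σ * Real.exp (s * centeredPermutedSum a σ) with hD
      set m := ∑ σ, Real.exp (s * centeredPermutedSum a σ) with hm
      set W := permutedSum fun i j => a i j ^ 2
      have hm0 : 0 ≤ m := Finset.sum_nonneg fun σ _ => (Real.exp_pos _).le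
      set θ : ℝ := 1 / (8 * M ^ 2) with hθ
      have hθ0 : 0 < θ := by positivity
      have hθM : 8 * M ^ 2 * θ = 1 := by rw [hθ]; field_simp
      -- the Gibbs variational inequality
      have h2 : θ * ∑ σ, W σ * Real.exp (s * centeredPermutedSum a σ) ≤
          2 * θ * sqMean a * m + s * D := by
        have h3 : ∑ σ, Real.exp (s * centeredPermutedSum a σ) *
            (θ * W σ - 2 * θ * sqMean a - s * centeredPermutedSum a σ + 1) ≤
            ∑ σ, Real.exp (θ * W σ) * Real.exp (-(2 * θ * sqMean a)) := by
          refine Finset.sum_le_sum fun σ _ => ?_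
          have h4 : Real.exp (θ * W σ) * Real.exp (-(2 * θ * sqMean a)) =
              Real.exp (s * centeredPermutedSum a σ) *
              Real.exp (θ * W σ - 2 * θ * sqMean a - s * centeredPermutedSum a σ) := by
            rw [← Real.exp_add, ← Real.exp_add]; congr 1; ring
          rw [h4]
          exact mul_le_mul_of_nonneg_left (Real.add_one_le_exp _) (Real.exp_pos _).le
        have h5 : ∑ σ, Real.exp (θ * W σ) * Real.exp (-(2 * θ * sqMean a)) ≤ n ! := by
          rw [← Finset.sum_mul, Real.exp_neg, ← div_eq_mul_inv, div_le_iff₀ (Real.exp_pos _)]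
          exact sum_exp_permutedSum_sq_le a hn hM hθ0.le hθM.le
        have h6 : ∑ σ, Real.exp (s * centeredPermutedSum a σ) *
            (θ * W σ - 2 * θ * sqMean a - s * centeredPermutedSum a σ + 1) =
            θ * (∑ σ, W σ * Real.exp (s * centeredPermutedSum a σ)) -
              2 * θ * sqMean a * m - s * D + m := by
          rw [hD, hm]
          simp only [Finset.mul_sum]
          rw [← Finset.sum_sub_distrib, ← Finset.sum_sub_distrib, ← Finset.sum_add_distrib]
          exact Finset.sum_congr rfl fun σ _ => by ring
        linarith
      have h7 : ∑ σ, W σ * Real.exp (s * centeredPermutedSum a σ) ≤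
          2 * sqMean a * m + 8 * M ^ 2 * s * D := by
        have := mul_le_mul_of_nonneg_left h2 (show 0 ≤ 8 * M ^ 2 by positivity)
        linear_combination this + (2 * sqMean a * m -
          ∑ σ, W σ * Real.exp (s * centeredPermutedSum a σ)) * hθM
      simp only [add_mul, Finset.sum_add_distrib, ← Finset.mul_sum] at h1
      rw [← hm] at h1
      have h8 : D ≤ 4 * s * (3 * sqMean a * m + 8 * M ^ 2 * s * D) :=
        h1.trans (mul_le_mul_of_nonneg_left (by linarith) (by positivity))
      have h9 : 8 * M * s ≤ 1 :=
        (mul_le_mul_of_nonneg_left hst (by positivity)).trans htM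
      have h10 : (8 * M * s) ^ 2 ≤ 1 := pow_le_one₀ (by positivity) h9
      rcases le_total D 0 with hD | hD
      · exact hD.trans (by positivity)
      · nlinarith [mul_le_mul_of_nonneg_right h10 hD]
  rw [Fintype.card_perm, Fintype.card_fin] at key
  convert key using 3
  ring

open Finset in
theorem card_le_centeredPermutedSum (hn : n ≠ 0) {M : ℝ} (hM0 : 0 < M)
    (hM : ∀ i j, |a i j| ≤ M) (hV : 0 < sqMean a) {x : ℝ} (hx : 0 < x) :
    (#{σ | 2 * √(2 * sqMean a * x) + 2 * M * x ≤ centeredPermutedSum a σ} : ℝ) ≤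
      n ! * Real.exp (-x / 16) := by
  set V := sqMean a with hVdef
  set u := 2 * √(2 * V * x) + 2 * M * x with hu
  obtain ⟨t, ht, htM, hbound⟩ : ∃ t, 0 ≤ t ∧ 8 * M * t ≤ 1 ∧ 12 * V * t ^ 2 - t * u ≤ -x / 16 := by
    set r := √(x / V) with hr
    have hr0 : 0 < r := Real.sqrt_pos.2 (by positivity)
    have hr2 : V * r ^ 2 = x := by
      rw [hr, Real.sq_sqrt (by positivity)]; field_simp
    have hs : V * r ≤ √(2 * V * x) := by
      refine Real.le_sqrt_of_sq_le ?_
      nlinarith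
    rcases le_total (r / 10) (1 / (8 * M)) with h | h
    · refine ⟨r / 10, by positivity, ?_, ?_⟩
      · rw [le_div_iff₀ (by positivity)] at h
        linarith
      · have h1 : r * (2 * (V * r)) ≤ r * u :=
          mul_le_mul_of_nonneg_left (by rw [hu]; nlinarith [mul_pos hM0 hx]) hr0.le
        nlinarith
    · refine ⟨1 / (8 * M), by positivity, by field_simp; rfl, ?_⟩
      have h1 : V * (1 / (8 * M)) ^ 2 ≤ V * (r / 10) ^ 2 := by gcongr
      have h2 : 1 / (8 * M) * (2 * M * x) ≤ 1 / (8 * M) * u := by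
        gcongr
        rw [hu]
        linarith [Real.sqrt_nonneg (2 * V * x)]
      have h3 : 1 / (8 * M) * (2 * M * x) = x / 4 := by field_simp; norm_num
      nlinarith
  have h1 : (#{σ | u ≤ centeredPermutedSum a σ} : ℝ) * Real.exp (t * u) ≤
      n ! * Real.exp (12 * V * t ^ 2) := by
    refine le_trans ?_ (sum_exp_centeredPermutedSum_le a hn hM0 hM ht htM)
    rw [← nsmul_eq_mul]
    refine (card_nsmul_le_sum _ (fun σ => Real.exp (t * centeredPermutedSum a σ)) _
      fun σ hσ => ?_).trans
      (sum_le_sum_of_subset_of_nonneg (subset_univ _) fun σ _ _ => (Real.exp_pos _).le)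
    exact Real.exp_le_exp.2 (mul_le_mul_of_nonneg_left (mem_filter.1 hσ).2 ht)
  rw [← le_div_iff₀ (Real.exp_pos _), mul_div_assoc, ← Real.exp_sub] at h1
  exact h1.trans (by gcongr)

open Finset in
theorem card_le_abs_centeredPermutedSum (hn : n ≠ 0) {M : ℝ} (hM0 : 0 < M)
    (hM : ∀ i j, |a i j| ≤ M) (hV : 0 < sqMean a) {x : ℝ} (hx : 0 < x) :
    (#{σ | 2 * √(2 * sqMean a * x) + 2 * M * x ≤ |centeredPermutedSum a σ|} : ℝ) ≤
      2 * (n ! * Real.exp (-x / 16)) := by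
  have hneg : sqMean (fun i j => -a i j) = sqMean a := by simp [sqMean]
  have h1 := card_le_centeredPermutedSum a hn hM0 hM hV hx
  have h2 := card_le_centeredPermutedSum (fun i j => -a i j) hn hM0 (by simpa using hM)
    (by rwa [hneg]) hx
  simp only [centeredPermutedSum_neg, hneg] at h2
  have h3 := card_union_le
    ({σ | 2 * √(2 * sqMean a * x) + 2 * M * x ≤ centeredPermutedSum a σ} : Finset _)
    ({σ | 2 * √(2 * sqMean a * x) + 2 * M * x ≤ -centeredPermutedSum a σ} : Finset _)
  rw [← filter_or] at h3
  simp only [← le_abs] at h3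
  have h4 : (_ : ℝ) ≤ _ := Nat.cast_le.2 h3
  push_cast at h4
  linarith

end PermutedSum

namespace IsUniformRandomPerm

variable {Ω : Type*} [MeasurableSpace Ω] {P : Measure Ω} {n : ℕ} {Pi : Ω → Equiv.Perm (Fin n)}

theorem real_preimage (hPi : IsUniformRandomPerm P Pi) (s : Finset (Equiv.Perm (Fin n))) :
    P.real (Pi ⁻¹' s) = s.card * (n ! : ℝ)⁻¹ := by
  have h : P (Pi ⁻¹' s) = s.card * (n ! : ℝ≥0∞)⁻¹ := by
    rw [← sum_measure_preimage_singleton s fun σ _ => hPi.measurableSet_preimage σ]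
    simp [hPi.prob_eq]
  simp [Measure.real, h]

theorem integral_comp [IsFiniteMeasure P] (hPi : IsUniformRandomPerm P Pi)
    (f : Equiv.Perm (Fin n) → ℝ) :
    ∫ ω, f (Pi ω) ∂P = (n ! : ℝ)⁻¹ * ∑ σ, f σ := by
  let _ : MeasurableSpace (Equiv.Perm (Fin n)) := ⊤
  have : DiscreteMeasurableSpace (Equiv.Perm (Fin n)) := ⟨fun _ => trivial⟩
  have hm : Measurable Pi := measurable_to_countable' hPi.measurableSet_preimage
  rw [← integral_map hm.aemeasurable (f := f) (measurable_of_finite f).aestronglyMeasurable,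
    integral_fintype (Integrable.of_finite), Finset.mul_sum]
  refine Finset.sum_congr rfl fun σ _ => ?_
  rw [map_measureReal_apply hm (MeasurableSet.singleton σ)]
  have := hPi.real_preimage {σ}
  simp only [Finset.coe_singleton, Finset.card_singleton, Nat.cast_one, one_mul] at this
  rw [this, smul_eq_mul]

theorem integral_permutedSum [IsFiniteMeasure P] (hPi : IsUniformRandomPerm P Pi) (hn : n ≠ 0)
    (a : Fin n → Fin n → ℝ) :
    ∫ ω, permutedSum a (Pi ω) ∂P = (1 / (n : ℝ)) * ∑ i, ∑ j, a i j := by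
  have h := sum_centeredPermutedSum a hn
  simp only [centeredPermutedSum, Finset.sum_sub_distrib, Finset.sum_const, Finset.card_univ,
    Fintype.card_perm, Fintype.card_fin, nsmul_eq_mul] at h
  have hn' : (n ! : ℝ) ≠ 0 := by exact_mod_cast n.factorial_ne_zero
  rw [hPi.integral_comp, sub_eq_zero.1 h, inv_mul_cancel_left₀ hn']

end IsUniformRandomPerm

theorem theorem2p1 {Ω : Type*} [MeasurableSpace Ω] (P : Measure Ω) [IsProbabilityMeasure P]
    {n : ℕ} (a : Fin n → Fin n → ℝ) (ha : ∃ i j, a i j ≠ 0)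
    (Pi : Ω → Equiv.Perm (Fin n)) (hPi : IsUniformRandomPerm P Pi)
    (x : ℝ) (hx : 0 < x) :
    P.real {ω | 2 * √(2 * sqMean a * x) + 2 * maxAbs a * x ≤
        |permutedSum a (Pi ω) - ∫ ω', permutedSum a (Pi ω') ∂P|} ≤
      16 * Real.exp (1 / 16) * Real.exp (-x / 16) := by
  obtain ⟨i, j, hij⟩ := ha
  have hn : n ≠ 0 := fun h => (Fin.cast h i).elim0
  have hn' : (0 : ℝ) < n := by exact_mod_cast Nat.pos_of_ne_zero hn
  have hM (i j : Fin n) : |a i j| ≤ maxAbs a :=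
    le_ciSup (f := fun p : Fin n × Fin n => |a p.1 p.2|) (Set.finite_range _).bddAbove (i, j)
  have hM0 : 0 < maxAbs a := (abs_pos.2 hij).trans_le (hM i j)
  have hV : 0 < sqMean a := by
    refine mul_pos (by positivity) ?_
    refine Finset.sum_pos' (fun i _ => by positivity) ⟨i, Finset.mem_univ i, ?_⟩
    exact Finset.sum_pos' (fun j _ => by positivity) ⟨j, Finset.mem_univ j, by positivity⟩
  have hcard := card_le_abs_centeredPermutedSum a hn hM0 hM hV hx
  have hreal := hPi.real_preimage
    {σ | 2 * √(2 * sqMean a * x) + 2 * maxAbs a * x ≤ |centeredPermutedSum a σ|}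
  rw [hPi.integral_permutedSum hn]
  have hset : {ω | 2 * √(2 * sqMean a * x) + 2 * maxAbs a * x ≤
      |permutedSum a (Pi ω) - (1 / (n : ℝ)) * ∑ i, ∑ j, a i j|} = Pi ⁻¹' ((Finset.univ.filter fun σ =>
      2 * √(2 * sqMean a * x) + 2 * maxAbs a * x ≤ |centeredPermutedSum a σ| :
        Finset (Equiv.Perm (Fin n))) : Set (Equiv.Perm (Fin n))) := by
    ext ω
    simp [centeredPermutedSum]
  rw [hset, hreal, ← div_eq_mul_inv, div_le_iff₀ (by positivity)]
  refine hcard.trans ?_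
  have h1 : 1 ≤ Real.exp (1 / 16) := Real.one_le_exp (by norm_num)
  have h2 : 0 ≤ (n ! : ℝ) * Real.exp (-x / 16) := by positivity
  nlinarith
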